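/- For a linear subspace $V\subseteq\mathbb R^N$ let $P_V$ be the orthogonal projection onto $V$. The unitarily invariant distribution on the $s$-dimensional subspaces of $\mathbb R^N$ is the Borel probability measure on the Grassmannian that is invariant under $V\mapsto UV$ for every orthogonal $U$. **Theorem.** For every $c>1$ there is $\varepsilon_0>0$, depending only on $c$, such that the following holds for all positive integers $K,s,N$ with $M=Ks\ge N\ge s$, all $0<\varepsilon<\varepsilon_0$, and $\delta>0$ determined by $\varepsilon=(1+\delta)^3-1$. Let $V_1,\dots,V_K$ be random $s$-dimensional subspaces of $\mathbb R^N$ that are independent and each distributed according to the unitarily invariant distribution, and let $P_1,\dots,P_K$ be the corresponding orthogonal projections. Then, with probability at least $$1-(R_1+R_2)\,\frac{K(K-1)}{2},$$ one has, for all $k\ne l$, $$1-c\,\varepsilon\Bigl(1+\sqrt{\tfrac Ns}\Bigr)\ \le\ \frac{N}{s^2}\operatorname{tr}[P_kP_l]\ \le\ 1+c\,\varepsilon\Bigl(1+\sqrt{\tfrac Ns}\Bigr)+\frac{N\varepsilon^2}{4s},$$ where $$R_1=2s\,e^{(1+\delta)s/2-s(s-1)(\delta^2/2-\delta^3/3)/2},$$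 $$R_2=2\Bigl(M+K\bigl(1+\tfrac4\delta\bigr)^s\Bigr)e^{-N\delta^2/4+N\delta^3/3}+2\bigl(1+\tfrac4\delta\bigr)^N e^{-M\delta^2/4+M\delta^3/3}.$$ -/

import Mathlib

open MeasureTheory ProbabilityTheory

noncomputable section

/-- The Grassmannian of `s`-dimensional linear subspaces of the Euclidean space `ℝ^N`. -/
def Gr (N s : ℕ) : Type :=
  {V : Submodule ℝ (EuclideanSpace ℝ (Fin N)) // Module.finrank ℝ V = s}

namespace Gr

variable {N s : ℕ}

/-- The orthogonal projection of `ℝ^N` onto the subspace `V`. -/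
def proj (V : Gr N s) : EuclideanSpace ℝ (Fin N) →L[ℝ] EuclideanSpace ℝ (Fin N) :=
  V.1.starProjection

/-- The Borel σ-algebra of the Grassmannian, whose usual topology is the one that is induced by
the embedding of `V` as the orthogonal projection onto `V`. -/
instance : MeasurableSpace (Gr N s) :=
  MeasurableSpace.comap proj inferInstance

/-- The image `U V` of a subspace `V` under an orthogonal transformation `U` of `ℝ^N`. -/
def rotate (U : EuclideanSpace ℝ (Fin N) ≃ₗᵢ[ℝ] EuclideanSpace ℝ (Fin N)) (V : Gr N s) :
    Gr N s :=
  ⟨V.1.map (U.toLinearEquiv : EuclideanSpace ℝ (Fin N) →ₗ[ℝ] EuclideanSpace ℝ (Fin N)),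
    (LinearEquiv.finrank_map_eq U.toLinearEquiv V.1).trans V.2⟩

lemma proj_rotate (U : EuclideanSpace ℝ (Fin N) ≃ₗᵢ[ℝ] EuclideanSpace ℝ (Fin N)) (V : Gr N s) :
    proj (rotate U V) =
      (U : EuclideanSpace ℝ (Fin N) →L[ℝ] EuclideanSpace ℝ (Fin N)) ∘L proj V ∘L
        (U.symm : EuclideanSpace ℝ (Fin N) →L[ℝ] EuclideanSpace ℝ (Fin N)) := by
  ext1 x
  exact Submodule.starProjection_map_apply U V.1 x

lemma measurable_rotate (U : EuclideanSpace ℝ (Fin N) ≃ₗᵢ[ℝ] EuclideanSpace ℝ (Fin N)) :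
    Measurable (rotate U : Gr N s → Gr N s) := by
  rw [measurable_comap_iff]
  have h : (proj ∘ rotate U : Gr N s → _) =
      (fun T : EuclideanSpace ℝ (Fin N) →L[ℝ] EuclideanSpace ℝ (Fin N) =>
        (U : EuclideanSpace ℝ (Fin N) →L[ℝ] EuclideanSpace ℝ (Fin N)) ∘L T ∘L
          (U.symm : EuclideanSpace ℝ (Fin N) →L[ℝ] EuclideanSpace ℝ (Fin N))) ∘ proj := by
    funext V
    exact proj_rotate U V
  rw [h]
  refine Measurable.comp (Continuous.measurable ?_) (comap_measurable _)
  fun_prop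

/-- A measure on the Grassmannian is unitarily invariant if it equals its image under every
orthogonal transformation of `ℝ^N`. -/
def IsUnitarilyInvariant (μ : Measure (Gr N s)) : Prop :=
  ∀ U : EuclideanSpace ℝ (Fin N) ≃ₗᵢ[ℝ] EuclideanSpace ℝ (Fin N), μ.map (rotate U) = μ

end Gr

/-- `{V_k}` is a family of `s`-dimensional subspaces of `ℝ^N` that are selected independently at
random, each of them according to the unitarily invariant distribution. -/
structure IsRandomSubspaceFamily {Ω : Type*} [MeasurableSpace Ω] (P : Measure Ω) {K N s : ℕ}
    (V : Fin K → Ω → Gr N s) : Prop where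
  measurable : ∀ k, Measurable (V k)
  indep : iIndepFun V P
  invariant : ∀ k, Gr.IsUnitarilyInvariant (P.map (V k))

/-- The first part `R₁` of the bound for the failure probability. -/
def failureR1 (s : ℕ) (δ : ℝ) : ℝ :=
  2 * s * Real.exp ((1 + δ) * s / 2 - s * (s - 1) * (δ ^ 2 / 2 - δ ^ 3 / 3) / 2)

/-- The second part `R₂` of the bound for the failure probability. -/
def failureR2 (K s N M : ℕ) (δ : ℝ) : ℝ :=
  2 * (M + K * (1 + 4 / δ) ^ s) * Real.exp (-N * δ ^ 2 / 4 + N * δ ^ 3 / 3) +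
    2 * (1 + 4 / δ) ^ N * Real.exp (-M * δ ^ 2 / 4 + M * δ ^ 3 / 3)

end

/-! The lower bound needs no concentration. Put `r = √(N/s)`. If `K ≥ 2` and `cε(1+r) < 1`, then
`Nδ² ≤ s`, the covering term `(1+4/δ)^s` pushes `R₂` above 1, and the asserted probability is
nonpositive. Otherwise there are no pairs, or the lower bound is at most 0 while the trace is
nonnegative.

For the upper bound, `tr[P_W P_V]` is the sum of `‖P_W b_i‖²` over an orthonormal basis of `V`. For
a randomly rotated unit vector, `‖P_W Uu‖` exceeds `√(s/N) + t` with probability at most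
`exp(-Nt²/2)`, by comparing Gaussian integrals. Union bounds over the `s` basis vectors and the
ordered pairs, with `t = ε/2`, give a failure probability that one term of `R₂` absorbs.

Invariance enters by averaging over a Haar rotation and applying Tonelli, so uniqueness of the
invariant law is not needed. -/

section Gaussian

variable {E : Type*} [NormedAddCommGroup E] [InnerProductSpace ℝ E] [FiniteDimensional ℝ E]
  [MeasurableSpace E] [BorelSpace E]

lemma lintegral_exp_neg_mul_sq_norm {b : ℝ} (hb : 0 < b) :
    ∫⁻ v : E, ENNReal.ofReal (Real.exp (-b * ‖v‖ ^ 2)) =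
      ENNReal.ofReal ((Real.pi / b) ^ (Module.finrank ℝ E / 2 : ℝ)) := by
  have h := GaussianFourier.integral_rexp_neg_mul_sq_norm (V := E) hb
  have hpos : 0 < (Real.pi / b) ^ (Module.finrank ℝ E / 2 : ℝ) :=
    Real.rpow_pos_of_pos (div_pos Real.pi_pos hb) _
  rw [← h, ofReal_integral_eq_lintegral_ofReal]
  · exact Integrable.of_integral_ne_zero (h ▸ hpos.ne')
  · exact Filter.Eventually.of_forall fun v => (Real.exp_pos _).le

/-- The integral of an anisotropic Gaussian with different variances along `W` and `Wᗮ`. -/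
lemma lintegral_exp_neg_mul_sq_norm_starProjection (W : Submodule ℝ E) {a b : ℝ}
    (ha : 0 < a) (hb : 0 < b) :
    ∫⁻ v : E, ENNReal.ofReal
        (Real.exp (-a * ‖W.starProjection v‖ ^ 2 - b * ‖Wᗮ.starProjection v‖ ^ 2)) =
      ENNReal.ofReal ((Real.pi / a) ^ (Module.finrank ℝ W / 2 : ℝ)) *
        ENNReal.ofReal ((Real.pi / b) ^ (Module.finrank ℝ Wᗮ / 2 : ℝ)) := by
  have h1 := (W.orthogonalDecomposition.measurePreserving).symm
    W.orthogonalDecomposition.toHomeomorph.toMeasurableEquiv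
  have h2 := h1.comp (WithLp.volume_preserving_toLp W Wᗮ)
  rw [← h2.lintegral_comp (by fun_prop), ← lintegral_exp_neg_mul_sq_norm ha,
    ← lintegral_exp_neg_mul_sq_norm hb, ← lintegral_prod_mul (by fun_prop) (by fun_prop)]
  refine lintegral_congr fun z => ?_
  rw [← ENNReal.ofReal_mul (Real.exp_pos _).le, ← Real.exp_add]
  set v : E := W.orthogonalDecomposition.symm (WithLp.toLp 2 z) with hv
  have hz : W.orthogonalDecomposition v = WithLp.toLp 2 z :=
    W.orthogonalDecomposition.apply_symm_apply _
  have hz1 : W.orthogonalProjectionOnto v = z.1 := by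
    rw [← W.fst_orthogonalDecomposition_apply, hz, WithLp.toLp_fst]
  have hz2 : Wᗮ.orthogonalProjectionOnto v = z.2 := by
    rw [← W.snd_orthogonalDecomposition_apply, hz, WithLp.toLp_snd]
  change ENNReal.ofReal (Real.exp (-a * ‖W.starProjection v‖ ^ 2 -
    b * ‖Wᗮ.starProjection v‖ ^ 2)) = _
  rw [Submodule.starProjection_apply, Submodule.starProjection_apply, hz1, hz2]
  congr 2
  simp only [Submodule.coe_norm]
  ring

end Gaussian

/-! ### Random rotations and the Gaussian comparison -/

section Orthogonal

variable {E : Type*} [NormedAddCommGroup E] [InnerProductSpace ℝ E] [FiniteDimensional ℝ E]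

instance compactSpace_unitary : CompactSpace (unitary (E →L[ℝ] E)) := by
  refine (isCompact_iff_compactSpace (s := (unitary (E →L[ℝ] E) : Set (E →L[ℝ] E)))).mp ?_
  refine Metric.isCompact_of_isClosed_isBounded isClosed_unitary ?_
  refine (Metric.isBounded_closedBall (x := (0 : E →L[ℝ] E)) (r := 1)).subset fun U hU => ?_
  rw [mem_closedBall_zero_iff]
  refine ContinuousLinearMap.opNorm_le_bound _ zero_le_one fun x => ?_
  rw [one_mul]
  exact ((Unitary.linearIsometryEquiv ⟨U, hU⟩).norm_map x).le

lemma norm_unitary_apply (U : unitary (E →L[ℝ] E)) (x : E) : ‖(U : E →L[ℝ] E) x‖ = ‖x‖ :=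
  (Unitary.linearIsometryEquiv U).norm_map x

/-- The reflection in the hyperplane orthogonal to `v - w` exchanges the two vectors. -/
lemma exists_unitary_apply_eq {v w : E} (h : ‖v‖ = ‖w‖) :
    ∃ R : unitary (E →L[ℝ] E), (R : E →L[ℝ] E) v = w := by
  refine ⟨Unitary.linearIsometryEquiv.symm (Submodule.reflection (Submodule.span ℝ {v - w})ᗮ), ?_⟩
  rw [Unitary.coe_symm_linearIsometryEquiv_apply]
  exact Submodule.reflection_sub h

/-- Inversion turns left Haar measure into a right-invariant one. Right invariance is the side
needed to replace `U u` by `U (R u)`. -/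
lemma exists_isProbabilityMeasure_isMulRightInvariant (G : Type*) [Group G] [TopologicalSpace G]
    [IsTopologicalGroup G] [CompactSpace G] [MeasurableSpace G] [BorelSpace G] :
    ∃ ν : Measure G, IsProbabilityMeasure ν ∧ ν.IsMulRightInvariant := by
  let K : TopologicalSpace.PositiveCompacts G := ⊤
  have hK : IsProbabilityMeasure (Measure.haarMeasure K) :=
    ⟨by simpa [K] using Measure.haarMeasure_self (K₀ := K)⟩
  refine ⟨(Measure.haarMeasure K).inv, ?_, inferInstance⟩
  exact Measure.isProbabilityMeasure_map measurable_inv.aemeasurable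

variable [MeasurableSpace (unitary (E →L[ℝ] E))] [BorelSpace (unitary (E →L[ℝ] E))]

/-- A random rotation of a fixed unit vector is rarely much closer to a subspace `W` than
expected. -/
lemma measure_lt_norm_sq_starProjection_unitary_le
    (ν : Measure (unitary (E →L[ℝ] E))) [IsProbabilityMeasure ν] [ν.IsMulRightInvariant]
    (W : Submodule ℝ E) {u : E} (hu : ‖u‖ = 1) {a b x : ℝ} (ha : 0 < a) (hab : a ≤ b)
    (hx : x * a + (1 - x) * b = 1) :
    ν {U | x < ‖W.starProjection ((U : E →L[ℝ] E) u)‖ ^ 2} ≤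
      ENNReal.ofReal (a ^ (-(Module.finrank ℝ W / 2 : ℝ)) *
        b ^ (-(Module.finrank ℝ Wᗮ / 2 : ℝ))) := by
  borelize E
  have hb : 0 < b := ha.trans_le hab
  set Φ := ν {U | x < ‖W.starProjection ((U : E →L[ℝ] E) u)‖ ^ 2} with hΦ
  let q : E → ℝ := fun v => Real.exp
    (-(a / 2) * ‖W.starProjection v‖ ^ 2 - b / 2 * ‖Wᗮ.starProjection v‖ ^ 2)
  have hq : Continuous q := by fun_prop
  have hF : Continuous fun z : unitary (E →L[ℝ] E) × E =>
      ENNReal.ofReal (q ((z.1 : E →L[ℝ] E) z.2)) := by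
    refine ENNReal.continuous_ofReal.comp (hq.comp ?_)
    exact (continuous_subtype_val.comp continuous_fst).clm_apply continuous_snd
  -- Markov's inequality in `U` for fixed `g`: on an event of probability `Φ`, the anisotropic
  -- weight at `U g` is at least the standard Gaussian weight at `g`.
  have key : ∀ g : E, ENNReal.ofReal (Real.exp (-(1 / 2) * ‖g‖ ^ 2)) * Φ ≤
      ∫⁻ U, ENNReal.ofReal (q ((U : E →L[ℝ] E) g)) ∂ν := by
    intro g
    obtain ⟨R, hR⟩ := exists_unitary_apply_eq (v := ‖g‖ • u) (w := g) (by simp [norm_smul, hu])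
    have hmeas : Measurable fun U : unitary (E →L[ℝ] E) =>
        ENNReal.ofReal (q ((U : E →L[ℝ] E) g)) :=
      (hF.comp (Continuous.prodMk_left g)).measurable
    refine le_trans ?_ (mul_meas_ge_le_lintegral hmeas
      (ENNReal.ofReal (Real.exp (-(1 / 2) * ‖g‖ ^ 2))))
    gcongr
    rw [hΦ, ← measure_preimage_mul_right ν R]
    refine measure_mono fun U hU => ?_
    have hU' : x < ‖W.starProjection ((U : E →L[ℝ] E) ((R : E →L[ℝ] E) u))‖ ^ 2 := hU
    refine ENNReal.ofReal_le_ofReal (Real.exp_le_exp.mpr ?_)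
    have h1 := Submodule.norm_sq_eq_add_norm_sq_starProjection ((U : E →L[ℝ] E) g) W
    rw [norm_unitary_apply] at h1
    have h2 : x * ‖g‖ ^ 2 ≤ ‖W.starProjection ((U : E →L[ℝ] E) g)‖ ^ 2 := by
      have : (U : E →L[ℝ] E) g = ‖g‖ • (U : E →L[ℝ] E) ((R : E →L[ℝ] E) u) := by
        conv_lhs => rw [← hR]
        simp
      rw [this, map_smul, norm_smul, mul_pow, norm_norm, mul_comm]
      gcongr
    -- By Pythagoras the doubled exponent is `b‖g‖² - (b-a)‖P_W Ug‖²`, at most `(xa + (1-x)b)‖g‖² =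
    -- ‖g‖²`.
    have h3 : 0 ≤ (b - a) * (‖W.starProjection ((U : E →L[ℝ] E) g)‖ ^ 2 - x * ‖g‖ ^ 2) :=
      mul_nonneg (sub_nonneg.mpr hab) (sub_nonneg.mpr h2)
    have h4 : (x * a + (1 - x) * b) * ‖g‖ ^ 2 = ‖g‖ ^ 2 := by rw [hx, one_mul]
    nlinarith
  have hint := lintegral_mono (μ := volume) key
  rw [lintegral_mul_const _ (by fun_prop), lintegral_exp_neg_mul_sq_norm (by norm_num),
    lintegral_lintegral_swap (f := fun g (U : unitary (E →L[ℝ] E)) =>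
      ENNReal.ofReal (q ((U : E →L[ℝ] E) g)))
      (hF.measurable.comp measurable_swap).aemeasurable] at hint
  -- Lebesgue measure is rotation invariant, so after Tonelli the inner integral does not depend on
  -- `U`.
  have hrot : ∀ U : unitary (E →L[ℝ] E), ∫⁻ g, ENNReal.ofReal (q ((U : E →L[ℝ] E) g)) =
      ENNReal.ofReal ((Real.pi / (a / 2)) ^ (Module.finrank ℝ W / 2 : ℝ)) *
        ENNReal.ofReal ((Real.pi / (b / 2)) ^ (Module.finrank ℝ Wᗮ / 2 : ℝ)) := by
    intro U
    rw [← lintegral_exp_neg_mul_sq_norm_starProjection W (half_pos ha) (half_pos hb)]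
    exact (Unitary.linearIsometryEquiv U).measurePreserving.lintegral_comp
      (hq.measurable.ennreal_ofReal)
  simp only [hrot, lintegral_const, measure_univ, mul_one] at hint
  have hpi : (0 : ℝ) < Real.pi / (1 / 2) := by positivity
  have hZ : 0 < (Real.pi / (1 / 2)) ^ (Module.finrank ℝ E / 2 : ℝ) := Real.rpow_pos_of_pos hpi _
  rw [← ENNReal.ofReal_mul (by positivity)] at hint
  have hfin : (Module.finrank ℝ E / 2 : ℝ) =
      (Module.finrank ℝ W / 2 : ℝ) + (Module.finrank ℝ Wᗮ / 2 : ℝ) := by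
    rw [← W.finrank_add_finrank_orthogonal]
    push_cast
    ring
  have hval : (Real.pi / (a / 2)) ^ (Module.finrank ℝ W / 2 : ℝ) *
      (Real.pi / (b / 2)) ^ (Module.finrank ℝ Wᗮ / 2 : ℝ) =
      (Real.pi / (1 / 2)) ^ (Module.finrank ℝ E / 2 : ℝ) *
        (a ^ (-(Module.finrank ℝ W / 2 : ℝ)) * b ^ (-(Module.finrank ℝ Wᗮ / 2 : ℝ))) := by
    rw [hfin, Real.rpow_add hpi, show Real.pi / (a / 2) = (Real.pi / (1 / 2)) / a by field_simp,
      show Real.pi / (b / 2) = (Real.pi / (1 / 2)) / b by field_simp,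
      Real.div_rpow hpi.le ha.le, Real.div_rpow hpi.le hb.le, Real.rpow_neg ha.le,
      Real.rpow_neg hb.le]
    ring
  rw [hval, ENNReal.ofReal_mul hZ.le] at hint
  exact (ENNReal.mul_le_mul_iff_right (ENNReal.ofReal_pos.mpr hZ).ne' ENNReal.ofReal_ne_top).mp hint

end Orthogonal

/-! ### Traces of products of projections -/

section Trace

variable {E : Type*} [NormedAddCommGroup E] [InnerProductSpace ℝ E] [FiniteDimensional ℝ E]

lemma trace_comp_starProjection {ι : Type*} [Fintype ι] (T : E →L[ℝ] E) (V : Submodule ℝ E)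
    (b : OrthonormalBasis ι ℝ V) :
    LinearMap.trace ℝ E (T ∘L V.starProjection).toLinearMap = ∑ i, inner ℝ (b i : E) (T (b i)) := by
  have h : (T ∘L V.starProjection).toLinearMap =
      (T.toLinearMap ∘ₗ V.subtype) ∘ₗ (V.orthogonalProjectionOnto : E →ₗ[ℝ] V) := by
    rfl
  rw [h, LinearMap.trace_comp_comm', LinearMap.trace_eq_sum_inner _ b]
  refine Finset.sum_congr rfl fun i _ => ?_
  simp

lemma trace_starProjection_comp_conj {ι : Type*} [Fintype ι] (U : E ≃ₗᵢ[ℝ] E)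
    (W V : Submodule ℝ E) (b : OrthonormalBasis ι ℝ V) :
    LinearMap.trace ℝ E (W.starProjection ∘L ((U : E →L[ℝ] E) ∘L V.starProjection ∘L
        (U.symm : E →L[ℝ] E))).toLinearMap = ∑ i, ‖W.starProjection (U (b i))‖ ^ 2 := by
  have h : (W.starProjection ∘L ((U : E →L[ℝ] E) ∘L V.starProjection ∘L
      (U.symm : E →L[ℝ] E))).toLinearMap =
      (W.starProjection ∘L (U : E →L[ℝ] E) ∘L V.starProjection).toLinearMap *
        (U.symm : E →L[ℝ] E).toLinearMap := rfl
  rw [h, LinearMap.trace_mul_comm]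
  have h' := trace_comp_starProjection
    ((U.symm : E →L[ℝ] E) ∘L W.starProjection ∘L (U : E →L[ℝ] E)) V b
  refine (h'.symm.trans ?_).symm.trans ?_
  · rfl
  refine Finset.sum_congr rfl fun i _ => ?_
  simp only [ContinuousLinearMap.comp_apply]
  change inner ℝ (b i : E) (U.symm (W.starProjection (U (b i)))) = _
  have hP : ∀ y : E, ‖W.starProjection y‖ ^ 2 = inner ℝ y (W.starProjection y) := fun y => by
    rw [← real_inner_self_eq_norm_sq, Submodule.inner_starProjection_left_eq_right,
      Submodule.starProjection_eq_self_iff.mpr (Submodule.starProjection_apply_mem _ _)]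
  rw [← U.inner_map_map, U.apply_symm_apply, hP]

lemma continuous_trace : Continuous fun T : E →L[ℝ] E => LinearMap.trace ℝ E T.toLinearMap :=
  LinearMap.continuous_of_finiteDimensional
    (LinearMap.trace ℝ E ∘ₗ ContinuousLinearMap.coeLM ℝ)

lemma continuous_trace_comp_unitary_conj (T : E →L[ℝ] E) :
    Continuous fun z : unitary (E →L[ℝ] E) × (E →L[ℝ] E) =>
      LinearMap.trace ℝ E (T ∘L ((z.1 : E →L[ℝ] E) ∘L z.2 ∘L
        ((star z.1 : unitary (E →L[ℝ] E)) : E →L[ℝ] E))).toLinearMap :=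
  continuous_trace.comp (continuous_const.clm_comp
    ((continuous_subtype_val.comp continuous_fst).clm_comp (continuous_snd.clm_comp
      (continuous_subtype_val.comp continuous_fst.star))))

end Trace

/-- The optimised Chernoff factor of the beta distribution in sub-Gaussian form. -/
lemma rpow_mul_rpow_le_exp {n q y : ℝ} (hn : 0 ≤ n) (hq : 0 < q) (hqy : q ≤ y) (hy : y < 1) :
    (q ^ 2 / y ^ 2) ^ (-(n * q ^ 2 / 2)) *
        ((1 - q ^ 2) / (1 - y ^ 2)) ^ (-(n * (1 - q ^ 2) / 2)) ≤
      Real.exp (-(n * (y - q) ^ 2 / 2)) := by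
  have hy0 : 0 < y := hq.trans_le hqy
  have hy1 : 0 < 1 - y ^ 2 := by nlinarith
  have hq1 : 0 < 1 - q ^ 2 := by nlinarith
  rw [Real.rpow_def_of_pos (by positivity), Real.rpow_def_of_pos (by positivity), ← Real.exp_add]
  refine Real.exp_le_exp.mpr ?_
  have h1 : -Real.log (q ^ 2 / y ^ 2) ≤ 2 * (y / q - 1) := by
    rw [← div_pow, Real.log_pow, ← mul_neg, ← Real.log_inv, inv_div]
    have := Real.log_le_sub_one_of_pos (div_pos hy0 hq)
    push_cast
    linarith
  have h2 : -Real.log ((1 - q ^ 2) / (1 - y ^ 2)) ≤ (1 - y ^ 2) / (1 - q ^ 2) - 1 := by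
    rw [← Real.log_inv, inv_div]
    exact Real.log_le_sub_one_of_pos (by positivity)
  have e1 : q ^ 2 * (y / q - 1) = q * y - q ^ 2 := by field_simp
  have e2 : (1 - q ^ 2) * ((1 - y ^ 2) / (1 - q ^ 2) - 1) = q ^ 2 - y ^ 2 := by
    field_simp
    ring
  have h3 := mul_le_mul_of_nonneg_left h1 (sq_nonneg q)
  have h4 := mul_le_mul_of_nonneg_left h2 hq1.le
  -- The two bounds from `log t ≤ t - 1` add up to `2(qy - q²) + (q² - y²)`, a perfect square up to
  -- sign.
  have h5 : q ^ 2 * -Real.log (q ^ 2 / y ^ 2) +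
      (1 - q ^ 2) * -Real.log ((1 - q ^ 2) / (1 - y ^ 2)) ≤ -(y - q) ^ 2 := by
    nlinarith
  have h6 := mul_le_mul_of_nonneg_left h5 (show 0 ≤ n / 2 by linarith)
  nlinarith

/-- A bound on all slices of a set in one direction bounds its slices in the other direction. -/
lemma measure_le_of_forall_slice_le {G X : Type*} [MeasurableSpace G] [MeasurableSpace X]
    (ν : Measure G) [IsProbabilityMeasure ν] (μ : Measure X) [IsProbabilityMeasure μ]
    {A : Set (G × X)} (hA : MeasurableSet A) {m C : ENNReal}
    (hm : ∀ g, m ≤ μ (Prod.mk g ⁻¹' A)) (hC : ∀ x, ν ((fun g => (g, x)) ⁻¹' A) ≤ C) : m ≤ C := by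
  calc m = ∫⁻ _, m ∂ν := by rw [lintegral_const, measure_univ, mul_one]
    _ ≤ ∫⁻ g, μ (Prod.mk g ⁻¹' A) ∂ν := lintegral_mono hm
    _ = ∫⁻ x, ν ((fun g => (g, x)) ⁻¹' A) ∂μ := by
        rw [← Measure.prod_apply hA, Measure.prod_apply_symm hA]
    _ ≤ ∫⁻ _, C ∂μ := lintegral_mono hC
    _ = C := by rw [lintegral_const, measure_univ, mul_one]

/-! ### Sub-Gaussian tail for a rotated unit vector -/

section Orthogonal

variable {E : Type*} [NormedAddCommGroup E] [InnerProductSpace ℝ E] [FiniteDimensional ℝ E]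
  [MeasurableSpace (unitary (E →L[ℝ] E))] [BorelSpace (unitary (E →L[ℝ] E))]

lemma measure_lt_norm_sq_starProjection_unitary_le_exp
    (ν : Measure (unitary (E →L[ℝ] E))) [IsProbabilityMeasure ν] [ν.IsMulRightInvariant]
    (W : Submodule ℝ E) (hW : 0 < Module.finrank ℝ W) {u : E} (hu : ‖u‖ = 1) {y : ℝ}
    (hy : √(Module.finrank ℝ W / Module.finrank ℝ E) ≤ y) :
    ν {U | y ^ 2 < ‖W.starProjection ((U : E →L[ℝ] E) u)‖ ^ 2} ≤
      ENNReal.ofReal (Real.exp (-(Module.finrank ℝ E *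
        (y - √(Module.finrank ℝ W / Module.finrank ℝ E)) ^ 2 / 2))) := by
  set q := √(Module.finrank ℝ W / Module.finrank ℝ E : ℝ) with hq
  have hN : 0 < Module.finrank ℝ E := hW.trans_le W.finrank_le
  have hW' : (0 : ℝ) < Module.finrank ℝ W := by exact_mod_cast hW
  have hN' : (0 : ℝ) < Module.finrank ℝ E := by exact_mod_cast hN
  have hq0 : 0 < q := Real.sqrt_pos.mpr (div_pos hW' hN')
  have hy0 : 0 < y := hq0.trans_le hy
  rcases le_or_gt 1 y with h1 | h1
  · have : {U : unitary (E →L[ℝ] E) |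
        y ^ 2 < ‖W.starProjection ((U : E →L[ℝ] E) u)‖ ^ 2} = ∅ := by
      refine Set.eq_empty_of_forall_notMem fun U hU => ?_
      have h2 := W.norm_starProjection_apply_le ((U : E →L[ℝ] E) u)
      rw [norm_unitary_apply, hu] at h2
      have h3 : y ^ 2 < ‖W.starProjection ((U : E →L[ℝ] E) u)‖ ^ 2 := hU
      have h4 := lt_of_pow_lt_pow_left₀ 2 (norm_nonneg _) h3
      linarith
    rw [this, measure_empty]
    exact zero_le
  · have hy1 : 0 < 1 - y ^ 2 := by nlinarith
    have hq1 : 0 < 1 - q ^ 2 := by nlinarith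
    have hs : (Module.finrank ℝ W : ℝ) = Module.finrank ℝ E * q ^ 2 := by
      rw [hq, Real.sq_sqrt (by positivity)]
      field_simp
    have hd : (Module.finrank ℝ Wᗮ : ℝ) = Module.finrank ℝ E * (1 - q ^ 2) := by
      have h := W.finrank_add_finrank_orthogonal
      have h' : (Module.finrank ℝ W : ℝ) + Module.finrank ℝ Wᗮ = Module.finrank ℝ E := by
        exact_mod_cast h
      linarith
    have hqy : q ^ 2 ≤ y ^ 2 := by gcongr
    -- The Chernoff-optimal weights; the constraint reads `q² + (1 - q²) = 1`.
    refine (measure_lt_norm_sq_starProjection_unitary_le ν W hu (a := q ^ 2 / y ^ 2)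
      (b := (1 - q ^ 2) / (1 - y ^ 2)) (by positivity) ?_ ?_).trans ?_
    · refine ((div_le_one (by positivity)).mpr hqy).trans ((one_le_div hy1).mpr (by linarith))
    · field_simp
      ring
    · rw [hs, hd]
      exact ENNReal.ofReal_le_ofReal (rpow_mul_rpow_le_exp hN'.le hq0 hy h1)

variable (E) in
lemma exists_unitary_isProbabilityMeasure_isMulRightInvariant :
    ∃ ν : Measure (unitary (E →L[ℝ] E)), IsProbabilityMeasure ν ∧ ν.IsMulRightInvariant :=
  exists_isProbabilityMeasure_isMulRightInvariant _

end Orthogonal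

/-! ### Overlap of random subspaces -/

namespace Gr

variable {N s : ℕ}

/-- The trace `tr[P_W P_V]` of the product of two orthogonal projections. -/
noncomputable def traceProd (W V : Gr N s) : ℝ :=
  LinearMap.trace ℝ (EuclideanSpace ℝ (Fin N)) (W.proj ∘L V.proj).toLinearMap

lemma measurable_proj : Measurable (proj : Gr N s → _) := comap_measurable _

lemma measurable_traceProd : Measurable fun p : Gr N s × Gr N s => traceProd p.1 p.2 := by
  have h : Continuous fun p : (EuclideanSpace ℝ (Fin N) →L[ℝ] EuclideanSpace ℝ (Fin N)) ×
      (EuclideanSpace ℝ (Fin N) →L[ℝ] EuclideanSpace ℝ (Fin N)) => p.1 ∘L p.2 :=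
    continuous_fst.clm_comp continuous_snd
  exact (continuous_trace.comp h).measurable.comp
    ((measurable_proj.comp measurable_fst).prodMk (measurable_proj.comp measurable_snd))

lemma traceProd_rotate {ι : Type*} [Fintype ι]
    (U : EuclideanSpace ℝ (Fin N) ≃ₗᵢ[ℝ] EuclideanSpace ℝ (Fin N)) (W V : Gr N s)
    (b : OrthonormalBasis ι ℝ V.1) :
    traceProd W (rotate U V) = ∑ i, ‖W.1.starProjection (U (b i))‖ ^ 2 := by
  rw [traceProd, proj_rotate]
  exact trace_starProjection_comp_conj U W.1 V.1 b

lemma traceProd_nonneg (W V : Gr N s) : 0 ≤ traceProd W V := by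
  have h : rotate (LinearIsometryEquiv.refl ℝ _) V = V := Subtype.ext (Submodule.map_id V.1)
  rw [← h, traceProd_rotate _ W V (stdOrthonormalBasis ℝ V.1)]
  positivity

/-- A random rotation of `V` rarely has a large overlap with `W`. -/
lemma measure_lt_traceProd_rotate_le
    [MeasurableSpace (unitary (EuclideanSpace ℝ (Fin N) →L[ℝ] EuclideanSpace ℝ (Fin N)))]
    [BorelSpace (unitary (EuclideanSpace ℝ (Fin N) →L[ℝ] EuclideanSpace ℝ (Fin N)))]
    (ν : Measure (unitary (EuclideanSpace ℝ (Fin N) →L[ℝ] EuclideanSpace ℝ (Fin N))))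
    [IsProbabilityMeasure ν] [ν.IsMulRightInvariant] (hs : 0 < s) (W V : Gr N s) {y : ℝ}
    (hy : √((s : ℝ) / N) ≤ y) :
    ν {U | s * y ^ 2 < traceProd W (rotate (Unitary.linearIsometryEquiv U) V)} ≤
      ENNReal.ofReal (s * Real.exp (-(N * (y - √((s : ℝ) / N)) ^ 2 / 2))) := by
  let b : OrthonormalBasis (Fin s) ℝ V.1 :=
    (stdOrthonormalBasis ℝ V.1).reindex (finCongr V.2)
  have hsub : {U | s * y ^ 2 < traceProd W (rotate (Unitary.linearIsometryEquiv U) V)} ⊆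
      ⋃ i ∈ (Finset.univ : Finset (Fin s)),
        {U : unitary (EuclideanSpace ℝ (Fin N) →L[ℝ] EuclideanSpace ℝ (Fin N)) |
          y ^ 2 < ‖W.1.starProjection
            ((U : EuclideanSpace ℝ (Fin N) →L[ℝ] EuclideanSpace ℝ (Fin N)) (b i))‖ ^ 2} := by
    intro U hU
    simp only [Set.mem_ofPred_eq, traceProd_rotate _ W V b] at hU
    by_contra hcon
    simp only [Set.mem_iUnion, Set.mem_ofPred_eq, not_exists, not_lt] at hcon
    refine absurd hU (not_lt.mpr ?_)
    refine (Finset.sum_le_sum fun i hi => hcon i hi).trans ?_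
    simp
  refine (measure_mono hsub).trans ((measure_biUnion_finset_le _ _).trans ?_)
  have hone : ∀ i : Fin s, ν {U | y ^ 2 < ‖W.1.starProjection
      ((U : EuclideanSpace ℝ (Fin N) →L[ℝ] EuclideanSpace ℝ (Fin N)) (b i))‖ ^ 2} ≤
      ENNReal.ofReal (Real.exp (-(N * (y - √((s : ℝ) / N)) ^ 2 / 2))) := by
    intro i
    have h := measure_lt_norm_sq_starProjection_unitary_le_exp ν W.1 (by rw [W.2]; exact hs)
      (u := (b i : EuclideanSpace ℝ (Fin N))) (b.norm_eq_one i) (y := y)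
    simp only [W.2, finrank_euclideanSpace_fin] at h
    exact h hy
  refine (Finset.sum_le_sum fun i _ => hone i).trans ?_
  rw [Finset.sum_const, Finset.card_univ, Fintype.card_fin, nsmul_eq_mul,
    ENNReal.ofReal_mul (Nat.cast_nonneg s), ENNReal.ofReal_natCast]

/-- A subspace with unitarily invariant distribution rarely has a large overlap with `W`. -/
lemma measure_lt_traceProd_le (μ : Measure (Gr N s)) [IsProbabilityMeasure μ]
    (hμ : IsUnitarilyInvariant μ) (hs : 0 < s) (W : Gr N s) {y : ℝ} (hy : √((s : ℝ) / N) ≤ y) :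
    μ {V | s * y ^ 2 < traceProd W V} ≤
      ENNReal.ofReal (s * Real.exp (-(N * (y - √((s : ℝ) / N)) ^ 2 / 2))) := by
  borelize ↥(unitary (EuclideanSpace ℝ (Fin N) →L[ℝ] EuclideanSpace ℝ (Fin N)))
  obtain ⟨ν, hν, hinv⟩ := exists_unitary_isProbabilityMeasure_isMulRightInvariant
    (EuclideanSpace ℝ (Fin N))
  have hW : Measurable fun V : Gr N s => traceProd W V :=
    Measurable.of_uncurry_left (f := traceProd) measurable_traceProd
  have hS : MeasurableSet {V : Gr N s | s * y ^ 2 < traceProd W V} :=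
    measurableSet_lt measurable_const hW
  let A : Set (unitary (EuclideanSpace ℝ (Fin N) →L[ℝ] EuclideanSpace ℝ (Fin N)) × Gr N s) :=
    {z | s * y ^ 2 < traceProd W (rotate (Unitary.linearIsometryEquiv z.1) z.2)}
  have hA : MeasurableSet A := by
    refine measurableSet_lt measurable_const ?_
    have hm := (continuous_trace_comp_unitary_conj W.proj).measurable.comp
      (measurable_fst.prodMk ((measurable_proj (N := N) (s := s)).comp measurable_snd))
    convert! hm using 2 with z
    rw [traceProd, proj_rotate]
    rfl
  refine measure_le_of_forall_slice_le ν μ hA (fun U => ?_)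
    fun V => measure_lt_traceProd_rotate_le ν hs W V hy
  -- Invariance of `μ` makes every slice at fixed `U` have the same measure; slices at fixed `V` are
  -- bounded by the rotation estimate.
  conv_lhs => rw [← hμ (Unitary.linearIsometryEquiv U)]
  rw [Measure.map_apply (measurable_rotate _) hS]
  rfl

end Gr

/-- By independence the pair has a product law, so `V k` can be frozen at a fixed `W`. -/
lemma IsRandomSubspaceFamily.measureReal_lt_traceProd_le {Ω : Type*} [MeasurableSpace Ω]
    {P : Measure Ω} [IsProbabilityMeasure P] {K N s : ℕ} {V : Fin K → Ω → Gr N s}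
    (hV : IsRandomSubspaceFamily P V) (hs : 0 < s) {k l : Fin K} (hkl : k ≠ l) {y : ℝ}
    (hy : √((s : ℝ) / N) ≤ y) :
    P.real {ω | s * y ^ 2 < Gr.traceProd (V k ω) (V l ω)} ≤
      s * Real.exp (-(N * (y - √((s : ℝ) / N)) ^ 2 / 2)) := by
  have : ∀ i, IsProbabilityMeasure (P.map (V i)) := fun i =>
    Measure.isProbabilityMeasure_map (hV.measurable i).aemeasurable
  have hmap := (indepFun_iff_map_prod_eq_prod_map_map (hV.measurable k).aemeasurable
    (hV.measurable l).aemeasurable).mp (hV.indep.indepFun hkl)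
  have hS : MeasurableSet {p : Gr N s × Gr N s | s * y ^ 2 < Gr.traceProd p.1 p.2} :=
    measurableSet_lt measurable_const Gr.measurable_traceProd
  refine ENNReal.toReal_le_of_le_ofReal (by positivity) ?_
  calc P {ω | s * y ^ 2 < Gr.traceProd (V k ω) (V l ω)}
      = P.map (fun ω => (V k ω, V l ω)) {p | s * y ^ 2 < Gr.traceProd p.1 p.2} := by
        rw [Measure.map_apply ((hV.measurable k).prodMk (hV.measurable l)) hS]
        rfl
    _ = ∫⁻ W, P.map (V l) (Prod.mk W ⁻¹' {p | s * y ^ 2 < Gr.traceProd p.1 p.2})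
          ∂(P.map (V k)) := by
        rw [hmap, Measure.prod_apply hS]
    _ ≤ ∫⁻ _, ENNReal.ofReal (s * Real.exp (-(N * (y - √((s : ℝ) / N)) ^ 2 / 2)))
          ∂(P.map (V k)) :=
        lintegral_mono fun W => Gr.measure_lt_traceProd_le _ (hV.invariant l) hs W hy
    _ = _ := by rw [lintegral_const, measure_univ, mul_one]

/-! ### Lower bounds for the failure probability, and the theorem -/

lemma failureR1_nonneg (s : ℕ) (δ : ℝ) : 0 ≤ failureR1 s δ := by
  unfold failureR1
  positivity

lemma mul_exp_le_failureR2 (K s N M : ℕ) {δ : ℝ} (hδ : 0 < δ) :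
    2 * (M * Real.exp (-N * δ ^ 2 / 4)) ≤ failureR2 K s N M δ := by
  have h1 : Real.exp (-N * δ ^ 2 / 4) ≤ Real.exp (-N * δ ^ 2 / 4 + N * δ ^ 3 / 3) :=
    Real.exp_le_exp.mpr (le_add_of_nonneg_right (by positivity))
  have h2 : (0 : ℝ) ≤ K * (1 + 4 / δ) ^ s := by positivity
  have h3 : 0 ≤ 2 * (1 + 4 / δ) ^ N * Real.exp (-M * δ ^ 2 / 4 + M * δ ^ 3 / 3) := by positivity
  unfold failureR2
  calc 2 * (M * Real.exp (-N * δ ^ 2 / 4))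
      ≤ 2 * ((M + K * (1 + 4 / δ) ^ s) * Real.exp (-N * δ ^ 2 / 4 + N * δ ^ 3 / 3)) := by
        gcongr
        linarith
    _ ≤ _ := by linarith

/-- The failure bound is vacuous unless `s` is small compared to `N δ²`. -/
lemma one_le_failureR2 {K s N M : ℕ} {δ : ℝ} (hK : 1 ≤ K) (hδ : 0 < δ) (hδ1 : δ ≤ 1)
    (h : N * δ ^ 2 ≤ s) : 1 ≤ failureR2 K s N M δ := by
  have hK' : (1 : ℝ) ≤ K := by exact_mod_cast hK
  have h0 : Real.exp (-s) ≤ Real.exp (-N * δ ^ 2 / 4 + N * δ ^ 3 / 3) := by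
    refine Real.exp_le_exp.mpr ?_
    have : 0 ≤ N * δ ^ 3 / 3 := by positivity
    have : 0 ≤ N * δ ^ 2 := by positivity
    linarith
  -- Since `δ ≤ 1`, the base is at least 5, hence exceeds `e`.
  have h1 : Real.exp s ≤ (1 + 4 / δ) ^ s := by
    rw [← mul_one (s : ℝ), Real.exp_nat_mul]
    have : 4 ≤ 4 / δ := (le_div_iff₀ hδ).mpr (by linarith)
    have := Real.exp_one_lt_d9
    exact pow_le_pow_left₀ (Real.exp_pos _).le (by linarith) _
  have h2 : 1 ≤ (M + K * (1 + 4 / δ) ^ s) * Real.exp (-N * δ ^ 2 / 4 + N * δ ^ 3 / 3) := by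
    calc (1 : ℝ) = Real.exp s * Real.exp (-s) := by rw [← Real.exp_add]; simp
      _ ≤ (M + K * (1 + 4 / δ) ^ s) * Real.exp (-N * δ ^ 2 / 4 + N * δ ^ 3 / 3) := by
        refine mul_le_mul ?_ h0 (Real.exp_pos _).le (by positivity)
        have hp : 0 ≤ (1 + 4 / δ) ^ s := by positivity
        have : (0 : ℝ) ≤ M := Nat.cast_nonneg M
        nlinarith
  have h3 : 0 ≤ 2 * (1 + 4 / δ) ^ N * Real.exp (-M * δ ^ 2 / 4 + M * δ ^ 3 / 3) := by positivity
  unfold failureR2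
  linarith

theorem theorem4p5 (c : ℝ) (hc : 1 < c) :
    ∃ ε₀ : ℝ, 0 < ε₀ ∧
      ∀ (K s N M : ℕ), 0 < s → M = K * s → N ≤ M → s ≤ N →
      ∀ (ε δ : ℝ), 0 < ε → ε < ε₀ → 0 < δ → ε = (1 + δ) ^ 3 - 1 →
      ∀ (Ω : Type*) [MeasurableSpace Ω] (P : Measure Ω) [IsProbabilityMeasure P]
        (V : Fin K → Ω → Gr N s), IsRandomSubspaceFamily P V →
        1 - (failureR1 s δ + failureR2 K s N M δ) * ((K : ℝ) * (K - 1) / 2) ≤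
          P.real {ω | ∀ k l : Fin K, k ≠ l →
            1 - c * ε * (1 + √((N : ℝ) / s)) ≤
                (N : ℝ) / (s : ℝ) ^ 2 *
                  LinearMap.trace ℝ (EuclideanSpace ℝ (Fin N))
                    ((V k ω).proj ∘L (V l ω).proj).toLinearMap ∧
              (N : ℝ) / (s : ℝ) ^ 2 *
                  LinearMap.trace ℝ (EuclideanSpace ℝ (Fin N))
                    ((V k ω).proj ∘L (V l ω).proj).toLinearMap ≤
                1 + c * ε * (1 + √((N : ℝ) / s)) + N * ε ^ 2 / (4 * s)} := by
  -- The same threshold works for every `c`: with `3δ ≤ ε` it ensures `δ ≤ 1`.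
  refine ⟨1, one_pos, ?_⟩
  intro K s N M hs hM hNM hsN ε δ hε hε1 hδ hεδ Ω _ P _ V hV
  have hs' : (0 : ℝ) < s := by exact_mod_cast hs
  have hN' : (0 : ℝ) < N := by exact_mod_cast hs.trans_le hsN
  have hε3 : 3 * δ ≤ ε := by
    have : ε = 3 * δ + (3 * δ ^ 2 + δ ^ 3) := by rw [hεδ]; ring
    have : 0 ≤ 3 * δ ^ 2 + δ ^ 3 := by positivity
    linarith
  have hR1 := failureR1_nonneg s δ
  set r := √((N : ℝ) / s) with hr
  have hr0 : 0 < r := Real.sqrt_pos.mpr (div_pos hN' hs')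
  have hr2 : r ^ 2 = N / s := Real.sq_sqrt (by positivity)
  by_cases hvac : 2 ≤ K ∧ c * ε * (1 + r) < 1
  · -- The claimed probability is not positive.
    obtain ⟨hK, hlt⟩ := hvac
    have hK' : (2 : ℝ) ≤ K := by exact_mod_cast hK
    have h1 : δ * r ≤ 1 := by
      have : ε ≤ c * ε := le_mul_of_one_le_left hε.le hc.le
      have : δ * r ≤ c * ε * (1 + r) :=
        mul_le_mul (by linarith) (by linarith) hr0.le (by linarith)
      linarith
    have h2 : N * δ ^ 2 ≤ s := by
      have h3 : (δ * r) ^ 2 ≤ 1 := pow_le_one₀ (by positivity) h1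
      rw [mul_pow, hr2, ← mul_div_assoc, div_le_one hs'] at h3
      linarith
    have h3 : 1 ≤ failureR2 K s N M δ :=
      one_le_failureR2 (by omega) hδ (by linarith) h2
    refine le_trans ?_ measureReal_nonneg
    have h4 : (1 : ℝ) ≤ K * (K - 1) / 2 := by nlinarith
    nlinarith
  · have hq : √((s : ℝ) / N) = r⁻¹ := by rw [hr, ← Real.sqrt_inv, inv_div]
    -- With this choice `(N/s²)·s·y² = (1 + εr/2)²`, whose quadratic term is exactly `Nε²/(4s)`.
    set y := √((s : ℝ) / N) + ε / 2 with hy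
    set A := {ω | ∀ k l : Fin K, k ≠ l →
      1 - c * ε * (1 + r) ≤ (N : ℝ) / (s : ℝ) ^ 2 * Gr.traceProd (V k ω) (V l ω) ∧
        (N : ℝ) / (s : ℝ) ^ 2 * Gr.traceProd (V k ω) (V l ω) ≤
          1 + c * ε * (1 + r) + N * ε ^ 2 / (4 * s)} with hA
    change _ ≤ P.real A
    let B := ⋃ p ∈ (Finset.univ : Finset (Fin K)).offDiag,
      {ω | s * y ^ 2 < Gr.traceProd (V p.1 ω) (V p.2 ω)}
    have hAB : Set.univ ⊆ A ∪ B := by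
      intro ω _
      by_contra hω
      rw [Set.mem_union, not_or] at hω
      refine hω.1 fun k l hkl => ⟨?_, ?_⟩
      · have hK : 2 ≤ K := by
          by_contra hK
          have := Fin.subsingleton_iff_le_one.mpr (show K ≤ 1 by omega)
          exact hkl (Subsingleton.elim _ _)
        have h1 : 1 ≤ c * ε * (1 + r) := not_lt.mp fun h => hvac ⟨hK, h⟩
        have h2 : 0 ≤ (N : ℝ) / (s : ℝ) ^ 2 * Gr.traceProd (V k ω) (V l ω) :=
          mul_nonneg (by positivity) (Gr.traceProd_nonneg _ _)
        linarith
      · have h1 : Gr.traceProd (V k ω) (V l ω) ≤ s * y ^ 2 := by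
          by_contra h
          refine hω.2 (Set.mem_biUnion (x := (k, l)) ?_ (not_le.mp h))
          simpa using hkl
        have h2 : (N : ℝ) / (s : ℝ) ^ 2 * (s * y ^ 2) =
            1 + ε * r + N * ε ^ 2 / (4 * s) := by
          have e1 : (N : ℝ) = r ^ 2 * s := by rw [hr2]; field_simp
          rw [hy, hq, e1]
          field_simp
          ring
        have h3 : ε * r ≤ c * ε * (1 + r) :=
          mul_le_mul (le_mul_of_one_le_left hε.le hc.le) (by linarith) hr0.le (by positivity)
        have h4 : (N : ℝ) / (s : ℝ) ^ 2 * Gr.traceProd (V k ω) (V l ω) ≤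
            (N : ℝ) / (s : ℝ) ^ 2 * (s * y ^ 2) := by gcongr
        linarith
    have hB : P.real B ≤ (K * (K - 1)) * (s * Real.exp (-N * δ ^ 2 / 4)) := by
      refine (measureReal_biUnion_finset_le _ _).trans ?_
      have hone : ∀ p ∈ (Finset.univ : Finset (Fin K)).offDiag,
          P.real {ω | s * y ^ 2 < Gr.traceProd (V p.1 ω) (V p.2 ω)} ≤
            s * Real.exp (-N * δ ^ 2 / 4) := by
        intro p hp
        refine (hV.measureReal_lt_traceProd_le hs (Finset.mem_offDiag.mp hp).2.2
          (by rw [hy]; linarith)).trans ?_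
        gcongr
        have h1 : y - √((s : ℝ) / N) = ε / 2 := by rw [hy]; ring
        have h2 : (3 * δ) ^ 2 ≤ ε ^ 2 := by gcongr
        -- The right side is `ε²/8 ≥ 9δ²/8`.
        have h3 : δ ^ 2 / 4 ≤ (ε / 2) ^ 2 / 2 := by nlinarith [sq_nonneg δ]
        rw [h1]
        have := mul_le_mul_of_nonneg_left h3 hN'.le
        linarith
      refine (Finset.sum_le_sum hone).trans_eq ?_
      rw [Finset.sum_const, Finset.offDiag_card, Finset.card_univ, Fintype.card_fin, nsmul_eq_mul,
        Nat.cast_sub (Nat.le_mul_self K)]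
      push_cast
      ring
    have hone : 1 ≤ P.real A + P.real B := by
      rw [← probReal_univ (μ := P)]
      exact (measureReal_mono hAB).trans (measureReal_union_le _ _)
    have hK : 1 ≤ K := Nat.one_le_iff_ne_zero.mpr (by rintro rfl; omega)
    have hK' : (1 : ℝ) ≤ K := by exact_mod_cast hK
    have hsM : (s : ℝ) ≤ M := by exact_mod_cast hsN.trans hNM
    have hR2 := mul_exp_le_failureR2 K s N M hδ
    have hKK : (0 : ℝ) ≤ K * (K - 1) / 2 := by nlinarith
    have hfin : (K * (K - 1)) * (s * Real.exp (-N * δ ^ 2 / 4)) ≤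
        (failureR1 s δ + failureR2 K s N M δ) * ((K : ℝ) * (K - 1) / 2) := by
      have h1 : s * Real.exp (-N * δ ^ 2 / 4) ≤ M * Real.exp (-N * δ ^ 2 / 4) := by gcongr
      -- The factor 2 in `R₂` pays for counting ordered pairs, and `s ≤ M` for the basis vectors.
      calc (K * (K - 1)) * (s * Real.exp (-N * δ ^ 2 / 4))
          = (2 * (s * Real.exp (-N * δ ^ 2 / 4))) * ((K : ℝ) * (K - 1) / 2) := by ring
        _ ≤ _ := mul_le_mul_of_nonneg_right (by linarith) hKK
    linarith
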